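/- A hypergraph $G=(V,E)$ has a finite vertex set $V$ and a finite family $E$ of hyperedges, each a nonempty subset of $V$ (parallel hyperedges are allowed); the rank of a hyperedge is its number of vertices, and $n=|V|$. $G$ is disconnected if $V$ can be partitioned into two nonempty sides such that every hyperedge lies entirely in one side. A cut is a set $C\subseteq E$ such that $G-C=(V,E\setminus C)$ is disconnected, and $\lambda$ is the minimum number of hyperedges in a cut of $G$. For $F\subseteq E$, the contracted hypergraph $G/F$ is obtained by merging, for each $e\in F$, all vertices of $e$ into one, and replacing every hyperedge by its image. For $q\in(0,1)$, $H\sim G(q)$ is the random hypergraph $G/F$, where $F$ contains each hyperedge of $G$ independently with probability $1-q$. (1) For every real $A>1$ there is a constant $n_0=n_0(A)$ such that the following holds for every real $B$ with $1<B<A$. Let $G$ be a hypergraph with $n\ge n_0$ vertices in which every hyperedge has rank at most $R=n/A$, let $q\in(0,1)$ and let $H\sim G(q)$. Then $$\Pr\bigl[\,|V(H)|\ge \lceil BR\rceil+1\,\bigr] < n^{A^2/B}\,q^{B\lambda}.$$ (2) There is a constant $n_0$ such that, for every hypergraph $G$ with $n\ge n_0$ vertices in which every hyperedge has rank at most $n/2$,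 every $q\in(0,1)$, and $H\sim G(q)$, $$\Pr\bigl[\,|V(H)|\ge 0.8\,n\,\bigr]\le n^{2.7}\,q^{1.5\lambda}.$$ -/

import Mathlib

/-- A hypergraph with vertex set `V` whose hyperedges are indexed by `E`: every hyperedge is a
nonempty set of vertices. Parallel hyperedges (distinct indices with the same vertex set) are
allowed; an injective `verts` is a hypergraph given by a set of hyperedges. -/
structure MultiHypergraph (V : Type*) (E : Type*) where
  /-- the set of vertices of a hyperedge -/
  verts : E → Finset V
  verts_nonempty : ∀ e, (verts e).Nonempty

namespace MultiHypergraph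

/-- The number of vertices. -/
noncomputable def numVertices {V E : Type*} (_G : MultiHypergraph V E) : ℕ := Nat.card V

/-- The rank of a hyperedge: its number of vertices. -/
def rank {V E : Type*} (G : MultiHypergraph V E) (e : E) : ℕ := (G.verts e).card

/-- `G - C`: delete the hyperedges in `C`, keep all vertices. -/
def deleteEdges {V E : Type*} (G : MultiHypergraph V E) (C : Finset E) :
    MultiHypergraph V {e : E // e ∉ C} where
  verts e := G.verts e
  verts_nonempty e := G.verts_nonempty e

/-- A hypergraph is disconnected if its vertices have a bipartition into two nonempty sides such
that every hyperedge is entirely contained in one of the sides. -/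
def IsDisconnected {V E : Type*} (G : MultiHypergraph V E) : Prop :=
  ∃ S : Set V, S.Nonempty ∧ Sᶜ.Nonempty ∧
    ∀ e, (G.verts e : Set V) ⊆ S ∨ (G.verts e : Set V) ⊆ Sᶜ

/-- A cut is a set `C` of hyperedges such that `G - C` is disconnected. -/
def IsCut {V E : Type*} (G : MultiHypergraph V E) (C : Finset E) : Prop :=
  (G.deleteEdges C).IsDisconnected

/-- The value `λ_G` of a minimum cut. (If there are finitely many hyperedges and at least two
vertices, then the set of all hyperedges is a cut, so the infimum is a minimum.) -/
noncomputable def minCut {V E : Type*} (G : MultiHypergraph V E) : ℕ :=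
  sInf {k : ℕ | ∃ C : Finset E, G.IsCut C ∧ C.card = k}

/-- The equivalence relation on vertices whose classes are the supervertices of `G / F`: the one
generated by identifying any two vertices that lie in a common hyperedge of `F`. -/
def contractSetoid {V E : Type*} (G : MultiHypergraph V E) (F : Finset E) : Setoid V :=
  Relation.EqvGen.setoid fun u v => ∃ e ∈ F, u ∈ G.verts e ∧ v ∈ G.verts e

open Classical in
/-- `G / F`: contract all hyperedges in `F`. The vertices are the supervertices, and every
hyperedge is replaced by its image under the natural map `V → V / F`. -/
noncomputable def contract {V E : Type*} (G : MultiHypergraph V E) (F : Finset E) :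
    MultiHypergraph (Quotient (G.contractSetoid F)) E where
  verts e := (G.verts e).image (Quotient.mk (G.contractSetoid F))
  verts_nonempty e := (G.verts_nonempty e).image _

open Classical in
/-- The probability, for `H ∼ G(q)`, that `H` has at least `x` vertices: `H = G / F`, where the
random set `F` contains each hyperedge independently with probability `1 - q`. -/
noncomputable def probNumVerticesGe {V E : Type*} [Fintype E] (G : MultiHypergraph V E)
    (q x : ℝ) : ℝ :=
  ∑ F : Finset E, if x ≤ ((G.contract F).numVertices : ℝ)
    then ∏ e : E, (if e ∈ F then 1 - q else q) else 0

end MultiHypergraph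

namespace MultiHypergraph

/-! Give `G / F` on `k` vertices the potential `(k / (B R)) ^ (2 B (B + 1))`, cut off to `0` once `k
< c`. Contracting a non-loop of rank `r` costs at least the fraction `B r / k` of it
(`potential_drop`). The non-loops at each supervertex form a cut, so their ranks sum to at least `k
λ` (`numVertices_mul_minCut_le`), and the drops sum to at least `B λ` times the potential. By
Russo's formula the expected potential divided by `q ^ (B λ)` is then nondecreasing in `q`;
comparison with `q = 1`, where nothing is contracted, and Markov's inequality give
`probNumVerticesGe_le`. For `R = n / A` the prefactor is bounded in terms of `A` alone, hence below
`n` for large `n`. -/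

/-! ### Product measure and Russo's formula -/

open Classical in
/-- The probability that a random subset of `E`, containing each element independently with
probability `1 - q`, equals `F`. -/
noncomputable def subsetWeight {E : Type*} [Fintype E] (q : ℝ) (F : Finset E) : ℝ :=
  ∏ e : E, (if e ∈ F then 1 - q else q)

lemma subsetWeight_nonneg {E : Type*} [Fintype E] {q : ℝ} (hq : 0 ≤ q) (hq1 : q ≤ 1)
    (F : Finset E) : 0 ≤ subsetWeight q F := by
  refine Finset.prod_nonneg fun e _ => ?_
  split_ifs <;> linarith

lemma subsetWeight_one {E : Type*} [Fintype E] {F : Finset E} (hF : F ≠ ∅) :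
    subsetWeight 1 F = 0 := by
  obtain ⟨e, he⟩ := Finset.nonempty_iff_ne_empty.mpr hF
  exact Finset.prod_eq_zero (Finset.mem_univ e) (by simp [he])

open Classical in
/-- **Russo's formula** for the product measure on subsets of a finite set. -/
lemma hasDerivAt_sum_subsetWeight {E : Type*} [Fintype E] (g : Finset E → ℝ) {q : ℝ}
    (hq : q ≠ 0) :
    HasDerivAt (fun t => ∑ F : Finset E, subsetWeight t F * g F)
      (q⁻¹ * ∑ F : Finset E, subsetWeight q F * ∑ e, (g F - g (insert e F))) q := by
  have hfac : ∀ (F : Finset E) (e : E), HasDerivAt (fun t : ℝ => if e ∈ F then 1 - t else t)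
      (if e ∈ F then -1 else 1) q := by
    intro F e
    by_cases he : e ∈ F
    · simpa [he] using (hasDerivAt_id q).const_sub 1
    · simpa [he] using hasDerivAt_id' q
  have hprod : ∀ F : Finset E, HasDerivAt (fun t => subsetWeight t F * g F)
      ((∑ e, (∏ e' ∈ Finset.univ.erase e, (if e' ∈ F then 1 - q else q)) *
        (if e ∈ F then -1 else 1)) * g F) q := by
    intro F
    have := (HasDerivAt.fun_finsetProd (u := Finset.univ) fun e _ => hfac F e).mul_const (g F)
    simpa [subsetWeight] using this
  refine (HasDerivAt.fun_sum (u := Finset.univ) fun F _ => hprod F).congr_deriv ?_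
  rw [eq_inv_mul_iff_mul_eq₀ hq]
  simp only [Finset.sum_mul, Finset.mul_sum]
  rw [Finset.sum_comm]
  conv_rhs => rw [Finset.sum_comm]
  refine Finset.sum_congr rfl fun e _ => ?_
  rw [← Finset.sum_filter_add_sum_filter_not Finset.univ (fun F : Finset E => e ∈ F)]
  conv_rhs => rw [← Finset.sum_filter_add_sum_filter_not Finset.univ (fun F : Finset E => e ∈ F)]
  have hzero : ∑ F with e ∈ F, subsetWeight q F * (g F - g (insert e F)) = 0 := by
    refine Finset.sum_eq_zero fun F hF => ?_
    rw [Finset.insert_eq_of_mem (Finset.mem_filter.mp hF).2, sub_self, mul_zero]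
  -- Erasing `e` pairs each set containing `e` with one that does not; the factor `q` completes the
  -- weight of the latter.
  have hbij : ∑ F with e ∈ F, q * ((∏ e' ∈ Finset.univ.erase e, (if e' ∈ F then 1 - q else q)) *
        (if e ∈ F then -1 else 1) * g F) =
      ∑ F with e ∉ F, -(subsetWeight q F * g (insert e F)) := by
    refine Finset.sum_nbij' (fun F => F.erase e) (fun F => insert e F) ?_ ?_ ?_ ?_ ?_
    · intro F _; simp
    · intro F _; simp
    · intro F hF; exact Finset.insert_erase (Finset.mem_filter.mp hF).2
    · intro F hF; exact Finset.erase_insert (Finset.mem_filter.mp hF).2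
    · intro F hF
      have he := (Finset.mem_filter.mp hF).2
      rw [subsetWeight, ← Finset.mul_prod_erase _ _ (Finset.mem_univ e), Finset.insert_erase he]
      have : ∏ e' ∈ Finset.univ.erase e, (if e' ∈ F.erase e then 1 - q else q) =
          ∏ e' ∈ Finset.univ.erase e, (if e' ∈ F then 1 - q else q) :=
        Finset.prod_congr rfl fun e' he' => by
          simp [Finset.mem_erase, Finset.ne_of_mem_erase he']
      rw [this]
      simp only [he, if_true, Finset.mem_erase, ne_eq, not_true_eq_false, false_and, if_false]
      ring
  rw [hzero, zero_add, hbij, ← Finset.sum_add_distrib]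
  refine Finset.sum_congr rfl fun F hF => ?_
  have he := (Finset.mem_filter.mp hF).2
  rw [subsetWeight, ← Finset.mul_prod_erase _ _ (Finset.mem_univ e)]
  simp only [he, if_false]
  ring

open Classical in
/-- If the decrements of `g` under adding single elements always sum to at least `c g`, then the
expectation of `g` is at most `q ^ c` times its initial value. -/
lemma sum_subsetWeight_mul_le {E : Type*} [Fintype E] (g : Finset E → ℝ) (c : ℝ)
    (hg : ∀ F, c * g F ≤ ∑ e, (g F - g (insert e F))) {q : ℝ} (hq : 0 < q) (hq1 : q < 1) :
    ∑ F : Finset E, subsetWeight q F * g F ≤ g ∅ * q ^ c := by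
  set Φ : ℝ → ℝ := fun t => ∑ F : Finset E, subsetWeight t F * g F with hΦ
  set Φ' : ℝ → ℝ := fun t =>
    t⁻¹ * ∑ F : Finset E, subsetWeight t F * ∑ e, (g F - g (insert e F)) with hΦ'
  have hder : ∀ t : ℝ, 0 < t → HasDerivAt (fun t => Φ t * t ^ (-c))
      (Φ' t * t ^ (-c) + Φ t * (-c * t ^ (-c - 1))) t := fun t ht =>
    (hasDerivAt_sum_subsetWeight g ht.ne').mul (Real.hasDerivAt_rpow_const (Or.inl ht.ne'))
  have hmono : MonotoneOn (fun t => Φ t * t ^ (-c)) (Set.Icc q 1) := by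
    refine monotoneOn_of_deriv_nonneg (convex_Icc q 1) ?_ ?_ ?_
    · intro t ht
      exact (hder t (hq.trans_le ht.1)).continuousAt.continuousWithinAt
    · intro t ht
      rw [interior_Icc] at ht
      exact (hder t (hq.trans ht.1)).differentiableAt.differentiableWithinAt
    · intro t ht
      rw [interior_Icc] at ht
      have ht0 : 0 < t := hq.trans ht.1
      rw [(hder t ht0).deriv, Real.rpow_sub_one ht0.ne']
      have hle : c * Φ t ≤
          ∑ F : Finset E, subsetWeight t F * ∑ e, (g F - g (insert e F)) := by
        rw [hΦ, Finset.mul_sum]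
        refine Finset.sum_le_sum fun F _ => ?_
        calc c * (subsetWeight t F * g F) = subsetWeight t F * (c * g F) := by ring
          _ ≤ _ := mul_le_mul_of_nonneg_left (hg F) (subsetWeight_nonneg ht0.le ht.2.le F)
      have : Φ' t * t ^ (-c) + Φ t * (-c * (t ^ (-c) / t)) = t⁻¹ * t ^ (-c) *
          ((∑ F : Finset E, subsetWeight t F * ∑ e, (g F - g (insert e F))) - c * Φ t) := by
        rw [hΦ']
        ring
      rw [this]
      have := Real.rpow_pos_of_pos ht0 (-c)
      have := sub_nonneg.mpr hle
      positivity
  have hone : Φ 1 = g ∅ := by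
    rw [hΦ]
    simp only
    rw [Finset.sum_eq_single ∅ (fun F _ hF => by rw [subsetWeight_one hF, zero_mul])
      (fun h => absurd (Finset.mem_univ _) h)]
    simp [subsetWeight]
  have h := hmono (Set.left_mem_Icc.mpr hq1.le) (Set.right_mem_Icc.mpr hq1.le) hq1.le
  simp only [Real.one_rpow, mul_one, hone] at h
  rw [Real.rpow_neg hq.le, ← div_eq_mul_inv, div_le_iff₀ (Real.rpow_pos_of_pos hq c)] at h
  exact h

/-! ### Contraction and star cuts -/

section Contract

variable {V E : Type*} (G : MultiHypergraph V E)

lemma minCut_le {C : Finset E} (hC : G.IsCut C) : G.minCut ≤ C.card :=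
  Nat.sInf_le ⟨C, hC, rfl⟩

lemma rank_contract_le (F : Finset E) (e : E) : (G.contract F).rank e ≤ G.rank e := by
  classical
  exact Finset.card_image_le

lemma contractSetoid_mono {F F' : Finset E} (h : F ⊆ F') :
    G.contractSetoid F ≤ G.contractSetoid F' := by
  intro u v huv
  exact Relation.EqvGen.mono (fun _ _ hab => hab.imp fun _ he => ⟨h he.1, he.2⟩) _ _ huv

lemma numVertices_contract_le [Finite V] (F : Finset E) :
    (G.contract F).numVertices ≤ G.numVertices :=
  Nat.card_le_card_of_surjective _ Quotient.mk_surjective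

open Classical in
/-- Contracting a further hyperedge of rank `r` removes at least `r - 1` vertices. -/
lemma numVertices_contract_insert_add_rank_le [Finite V] (F : Finset E) (e : E) :
    (G.contract (insert e F)).numVertices + (G.contract F).rank e ≤
      (G.contract F).numVertices + 1 := by
  have := Fintype.ofFinite (Quotient (G.contractSetoid F))
  have := Fintype.ofFinite (Quotient (G.contractSetoid (insert e F)))
  set π : Quotient (G.contractSetoid F) → Quotient (G.contractSetoid (insert e F)) :=
    Quotient.map' id (fun u v h => G.contractSetoid_mono (Finset.subset_insert e F) h) with hπ
  have hmk : ∀ v, π (Quotient.mk _ v) = Quotient.mk _ v := fun v => rfl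
  obtain ⟨v₀, hv₀⟩ := G.verts_nonempty e
  set I := (G.contract F).verts e
  have hI : ∀ x ∈ I, π x = Quotient.mk _ v₀ := by
    intro x hx
    obtain ⟨v, hv, rfl⟩ := Finset.mem_image.mp hx
    rw [hmk]
    exact Quotient.sound (Relation.EqvGen.rel _ _ ⟨e, Finset.mem_insert_self e F, hv, hv₀⟩)
  have hcover : (Finset.univ : Finset (Quotient (G.contractSetoid (insert e F)))) ⊆
      insert (Quotient.mk _ v₀) (Iᶜ.image π) := by
    intro y _
    obtain ⟨v, rfl⟩ := Quotient.mk_surjective y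
    by_cases hv : Quotient.mk _ v ∈ I
    · rw [← hmk v, hI _ hv]
      exact Finset.mem_insert_self _ _
    · exact Finset.mem_insert_of_mem
        (Finset.mem_image.mpr ⟨_, Finset.mem_compl.mpr hv, hmk v⟩)
  have h1 := (Finset.card_le_card hcover).trans (Finset.card_insert_le _ _)
  have h2 : (Iᶜ.image π).card ≤ Iᶜ.card := Finset.card_image_le
  have h3 := Finset.card_add_card_compl I
  simp only [numVertices, rank, Nat.card_eq_fintype_card]
  rw [Finset.card_univ] at h1
  change _ + I.card ≤ _
  omega

open Classical in
/-- The hyperedges that are incident to a vertex of `G / F` and are not loops form a cut. -/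
lemma isCut_star [Finite V] [Fintype E] (F : Finset E)
    (hk : 2 ≤ (G.contract F).numVertices) (x : Quotient (G.contractSetoid F)) :
    G.IsCut {e | x ∈ (G.contract F).verts e ∧ 2 ≤ (G.contract F).rank e} := by
  have : Nontrivial (Quotient (G.contractSetoid F)) := Finite.one_lt_card_iff_nontrivial.mp hk
  obtain ⟨y, hy⟩ := exists_ne x
  obtain ⟨u, rfl⟩ := Quotient.mk_surjective x
  obtain ⟨w, rfl⟩ := Quotient.mk_surjective y
  -- One side is the fibre over `x`: a surviving hyperedge that meets it is a loop, so it lies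
  -- inside.
  refine ⟨{v | Quotient.mk (G.contractSetoid F) v = Quotient.mk _ u}, ⟨u, rfl⟩, ⟨w, hy⟩, ?_⟩
  rintro ⟨e, he⟩
  simp only [Finset.mem_filter, Finset.mem_univ, true_and, not_and, not_le] at he
  have hmem : ∀ v ∈ G.verts e, Quotient.mk _ v ∈ (G.contract F).verts e :=
    fun v hv => Finset.mem_image_of_mem _ hv
  by_cases hu : Quotient.mk _ u ∈ (G.contract F).verts e
  · left
    intro v hv
    exact Finset.card_le_one.mp (Nat.lt_succ_iff.mp (he hu)) _ (hmem v hv) _ hu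
  · right
    intro v hv hvu
    exact hu (hvu ▸ hmem v hv)

open Classical in
/-- The non-loop hyperedges of `G / F` have total rank at least `|V(G / F)| λ`. -/
lemma numVertices_mul_minCut_le [Finite V] [Fintype E] (F : Finset E)
    (hk : 2 ≤ (G.contract F).numVertices) :
    (G.contract F).numVertices * G.minCut ≤
      ∑ e with 2 ≤ (G.contract F).rank e, (G.contract F).rank e := by
  have := Fintype.ofFinite (Quotient (G.contractSetoid F))
  calc (G.contract F).numVertices * G.minCut
      = ∑ _x : Quotient (G.contractSetoid F), G.minCut := by
        simp [numVertices]
    _ ≤ ∑ x : Quotient (G.contractSetoid F),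
          (({e ∈ Finset.univ.filter fun e => 2 ≤ (G.contract F).rank e |
            x ∈ (G.contract F).verts e} : Finset E)).card := by
        refine Finset.sum_le_sum fun x _ => (G.minCut_le (G.isCut_star F hk x)).trans_eq ?_
        congr 1
        ext e
        simp [and_comm]
    _ = ∑ e with 2 ≤ (G.contract F).rank e,
          (Finset.univ.filter fun x => x ∈ (G.contract F).verts e).card :=
        Finset.sum_card_bipartiteAbove_eq_sum_card_bipartiteBelow
          (fun (x : Quotient (G.contractSetoid F)) e => x ∈ (G.contract F).verts e)
    _ = _ := by
        refine Finset.sum_congr rfl fun e _ => ?_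
        rw [Finset.filter_univ_mem]
        rfl

end Contract

/-! ### The truncated power potential -/

/-- The potential of a hypergraph with `x` vertices: it vanishes below the threshold `c`. -/
noncomputable def potential (c L α x : ℝ) : ℝ :=
  if x < c then 0 else (x / L) ^ α

lemma potential_nonneg {c L α x : ℝ} (hL : 0 < L) (hc : 0 < c) : 0 ≤ potential c L α x := by
  unfold potential
  split_ifs with h
  · exact le_rfl
  · exact Real.rpow_nonneg (div_nonneg (hc.le.trans (not_lt.mp h)) hL.le) _

lemma potential_mono {c L α : ℝ} (hL : 0 < L) (hc : 0 < c) (hα : 0 ≤ α) :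
    Monotone (potential c L α) := by
  intro x y hxy
  by_cases hx : x < c
  · rw [potential, if_pos hx]
    exact potential_nonneg hL hc
  · have hx0 : 0 < x := hc.trans_le (not_lt.mp hx)
    rw [potential, if_neg hx, potential, if_neg fun hy => hx (hxy.trans_lt hy)]
    gcongr

/-- Since `r ≥ 2`, the loss `r - 1` is at least `r / 2`, so the exponent `2 B (B + 1)` gives a
factor at most `exp (-B (B + 1) r / k)`. This beats `1 - B r / k` as long as `(B + 1) r ≤ k`;
otherwise `k' < c` and the cutoff applies. -/
lemma potential_drop {B R c k k' r : ℝ} (hB : 1 < B) (hR : 0 < R) (hc : B * R + 1 ≤ c)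
    (hr : 2 ≤ r) (hrR : r ≤ R) (hk : c ≤ k) (hk' : k' ≤ k - r + 1) :
    potential c (B * R) (2 * B * (B + 1)) k' ≤
      (1 - B * r / k) * potential c (B * R) (2 * B * (B + 1)) k := by
  have hBR : 0 < B * R := by positivity
  have hk0 : 0 < k := by linarith
  have hBrR : B * r ≤ B * R := by gcongr
  by_cases h : k' < c
  · rw [potential, if_pos h]
    refine mul_nonneg ?_ (potential_nonneg hBR (by linarith))
    rw [sub_nonneg, div_le_one hk0]
    linarith
  · have hk'c := not_lt.mp h
    rw [potential, if_neg h, potential, if_neg hk.not_gt]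
    have hk'0 : 0 < k' := by linarith
    have hα : 0 ≤ 2 * B * (B + 1) := by positivity
    have hsplit : k' / (B * R) = k' / k * (k / (B * R)) := by field_simp
    rw [hsplit, Real.mul_rpow (by positivity) (by positivity)]
    refine mul_le_mul_of_nonneg_right ?_ (by positivity)
    have h1 : k' / k ≤ Real.exp (-(r / (2 * k))) := by
      refine le_trans ?_ (Real.add_one_le_exp _)
      have : -(r / (2 * k)) + 1 = (k - r / 2) / k := by field_simp; ring
      rw [this]
      gcongr
      linarith
    have h2 : (k' / k) ^ (2 * B * (B + 1)) ≤ Real.exp (-(B * (B + 1) * (r / k))) := by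
      calc (k' / k) ^ (2 * B * (B + 1))
          ≤ Real.exp (-(r / (2 * k))) ^ (2 * B * (B + 1)) := by gcongr
        _ = _ := by
          rw [← Real.exp_mul]
          congr 1
          field_simp
    refine h2.trans ?_
    set x := r / k with hx
    have hx0 : 0 ≤ x := by positivity
    -- Here `k ≥ k' + r - 1 ≥ c + r - 1 ≥ B R + r`, which uses the `+ 1` in `hc`.
    have hxk : (B + 1) * x ≤ 1 := by
      rw [hx, ← mul_div_assoc, div_le_one hk0]
      nlinarith
    have hy : 0 < 1 + B * (B + 1) * x := by positivity
    rw [Real.exp_neg, mul_div_assoc, ← hx]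
    refine inv_le_of_inv_le₀ ?_ ?_
    · nlinarith
    · refine le_trans ?_ (Real.add_one_le_exp _)
      have hpos : 0 < 1 - B * x := by nlinarith
      rw [inv_le_comm₀ hpos (by linarith), inv_eq_one_div, div_le_iff₀ (by linarith)]
      -- This is `(1 - B x) (1 + B (B + 1) x) - 1`.
      have : 0 ≤ B ^ 2 * x * (1 - (B + 1) * x) :=
        mul_nonneg (by positivity) (by linarith)
      nlinarith

/-! ### Tail bounds -/

/-- If every hyperedge has rank at most `R`, the probability that at least `c ≥ B R + 1` vertices
survive the contraction is at most `(n / (B R)) ^ (2 B (B + 1)) q ^ (B λ)`. -/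
lemma probNumVerticesGe_le {V E : Type*} [Finite V] [Fintype E] (G : MultiHypergraph V E)
    {B R c q : ℝ} (hB : 1 < B) (hR : 1 ≤ R) (hc : B * R + 1 ≤ c) (hcn : c ≤ G.numVertices)
    (hrank : ∀ e, (G.rank e : ℝ) ≤ R) (hq : 0 < q) (hq1 : q < 1) :
    G.probNumVerticesGe q c ≤
      ((G.numVertices : ℝ) / (B * R)) ^ (2 * B * (B + 1)) * q ^ (B * (G.minCut : ℝ)) := by
  classical
  have hBR : 1 < B * R := by nlinarith
  have hα : 0 ≤ 2 * B * (B + 1) := by positivity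
  set f := potential c (B * R) (2 * B * (B + 1)) with hf
  have hf0 : ∀ x, 0 ≤ f x := fun x => potential_nonneg (by linarith) (by linarith)
  have hfm : Monotone f := potential_mono (by linarith) (by linarith) hα
  have hdrop : ∀ F : Finset E, B * G.minCut * f (G.contract F).numVertices ≤
      ∑ e, (f (G.contract F).numVertices - f (G.contract (insert e F)).numVertices) := by
    intro F
    have hnum : ∀ e, ((G.contract (insert e F)).numVertices : ℝ) ≤
        (G.contract F).numVertices - (G.contract F).rank e + 1 := by
      intro e
      have : (((G.contract (insert e F)).numVertices + (G.contract F).rank e : ℕ) : ℝ) ≤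
          ((G.contract F).numVertices + 1 : ℕ) :=
        Nat.cast_le.mpr (G.numVertices_contract_insert_add_rank_le F e)
      push_cast at this
      linarith
    have hterm : ∀ e, 0 ≤
        f (G.contract F).numVertices - f (G.contract (insert e F)).numVertices := by
      intro e
      refine sub_nonneg.mpr (hfm ?_)
      have : (1 : ℝ) ≤ (G.contract F).rank e :=
        Nat.one_le_cast.mpr (Finset.card_pos.mpr ((G.contract F).verts_nonempty e))
      linarith [hnum e]
    set k : ℝ := ((G.contract F).numVertices : ℝ) with hk
    by_cases hkc : k < c
    · rw [show f k = 0 from if_pos hkc, mul_zero]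
      refine Finset.sum_nonneg fun e _ => ?_
      have := hterm e
      rwa [show f k = 0 from if_pos hkc] at this
    · have hck := not_lt.mp hkc
      have hk0 : 0 < k := by linarith
      have hk2 : 2 ≤ (G.contract F).numVertices := by
        have : (2 : ℝ) ≤ k := by linarith
        rw [hk] at this
        exact_mod_cast this
      have hsum : k * G.minCut ≤
          ∑ e with 2 ≤ (G.contract F).rank e, ((G.contract F).rank e : ℝ) := by
        rw [hk]
        exact_mod_cast G.numVertices_mul_minCut_le F hk2
      calc B * G.minCut * f k = B / k * f k * (k * G.minCut) := by field_simp
        _ ≤ B / k * f k *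
            ∑ e with 2 ≤ (G.contract F).rank e, ((G.contract F).rank e : ℝ) := by
          refine mul_le_mul_of_nonneg_left hsum (mul_nonneg (by positivity) (hf0 k))
        _ = ∑ e with 2 ≤ (G.contract F).rank e, B / k * f k * (G.contract F).rank e :=
          Finset.mul_sum _ _ _
        _ ≤ ∑ e with 2 ≤ (G.contract F).rank e,
            (f k - f (G.contract (insert e F)).numVertices) := by
          refine Finset.sum_le_sum fun e he => ?_
          have h := potential_drop hB (by linarith) hc
            (show (2 : ℝ) ≤ (G.contract F).rank e from
              by exact_mod_cast (Finset.mem_filter.mp he).2)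
            ((Nat.cast_le.mpr (G.rank_contract_le F e)).trans (hrank e)) hck (hnum e)
          rw [← hf] at h
          have : B / k * f k * (G.contract F).rank e =
            B * (G.contract F).rank e / k * f k := by ring
          linarith
        _ ≤ _ := Finset.sum_le_sum_of_subset_of_nonneg (Finset.filter_subset _ _)
          fun e _ _ => hterm e
  calc G.probNumVerticesGe q c
      ≤ ∑ F : Finset E, subsetWeight q F * f (G.contract F).numVertices := by
        refine Finset.sum_le_sum fun F _ => ?_
        have hw := subsetWeight_nonneg hq.le hq1.le F
        split_ifs with h
        -- Markov: the potential is at least `1` from `c` on, as `c ≥ B R`.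
        · refine le_mul_of_one_le_right hw ?_
          rw [hf, potential, if_neg h.not_gt]
          refine Real.one_le_rpow ?_ hα
          rw [one_le_div (by linarith)]
          linarith
        · exact mul_nonneg hw (hf0 _)
    _ ≤ f (G.contract ∅).numVertices * q ^ (B * (G.minCut : ℝ)) :=
        sum_subsetWeight_mul_le (fun F => f (G.contract F).numVertices) _ hdrop hq hq1
    _ ≤ f G.numVertices * q ^ (B * (G.minCut : ℝ)) := by
        refine mul_le_mul_of_nonneg_right (hfm ?_) (Real.rpow_nonneg hq.le _)
        exact_mod_cast G.numVertices_contract_le ∅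
    _ = _ := by rw [hf, potential, if_neg hcn.not_gt]

lemma probNumVerticesGe_eq_zero {V E : Type*} [Finite V] [Fintype E] (G : MultiHypergraph V E)
    (q : ℝ) {c : ℝ} (hc : (G.numVertices : ℝ) < c) : G.probNumVerticesGe q c = 0 := by
  refine Finset.sum_eq_zero fun F _ => if_neg ?_
  rw [not_le]
  exact (Nat.cast_le.mpr (G.numVertices_contract_le F)).trans_lt hc

lemma probNumVerticesGe_antitone {V E : Type*} [Fintype E] (G : MultiHypergraph V E)
    {q : ℝ} (hq : 0 < q) (hq1 : q < 1) : Antitone (G.probNumVerticesGe q) := by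
  intro c d hcd
  refine Finset.sum_le_sum fun F _ => ?_
  have hw := subsetWeight_nonneg hq.le hq1.le F
  rw [subsetWeight] at hw
  split_ifs with h h' h'
  · exact le_rfl
  · exact absurd (hcd.trans h) h'
  · exact hw
  · exact le_rfl

/-- Hypergraphs of rank at most `n / A` have fewer than `⌈B n / A⌉ + 1` vertices left, except
with probability less than `n ^ (A ^ 2 / B) q ^ (B λ)`. -/
lemma probNumVerticesGe_ceil_lt {A B q : ℝ} (hB : 1 < B) (hBA : B < A)
    {V E : Type*} [Finite V] [Fintype E] (G : MultiHypergraph V E)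
    (hn : A ^ (2 * A * (A + 1)) < G.numVertices)
    (hrank : ∀ e, (G.rank e : ℝ) ≤ (G.numVertices : ℝ) / A) (hq : 0 < q) (hq1 : q < 1) :
    G.probNumVerticesGe q ((⌈B * ((G.numVertices : ℝ) / A)⌉ : ℝ) + 1) <
      (G.numVertices : ℝ) ^ (A ^ 2 / B) * q ^ (B * (G.minCut : ℝ)) := by
  have hA : 1 < A := hB.trans hBA
  set n : ℝ := (G.numVertices : ℝ) with hndef
  have hAn : A < n := by
    refine lt_of_le_of_lt ?_ hn
    exact Real.self_le_rpow_of_one_le hA.le (by nlinarith)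
  have hn0 : 0 < n := by linarith
  have hqpos := Real.rpow_pos_of_pos hq (B * (G.minCut : ℝ))
  by_cases hcn : (⌈B * (n / A)⌉ : ℝ) + 1 ≤ n
  · have hR : 1 ≤ n / A := by rw [one_le_div (by linarith)]; exact hAn.le
    refine (G.probNumVerticesGe_le hB hR (by linarith [Int.le_ceil (B * (n / A))]) hcn hrank
      hq hq1).trans_lt (mul_lt_mul_of_pos_right ?_ hqpos)
    have hratio : n / (B * (n / A)) = A / B := by field_simp
    rw [← hndef, hratio]
    -- Bounding by `B < A` makes `n₀` independent of `B`; one factor `n` suffices because `A ^ 2 / B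
    -- > 1`.
    calc (A / B) ^ (2 * B * (B + 1)) ≤ A ^ (2 * B * (B + 1)) := by
          gcongr
          exact div_le_self (by linarith) hB.le
      _ ≤ A ^ (2 * A * (A + 1)) := by
          refine Real.rpow_le_rpow_of_exponent_le hA.le ?_
          gcongr
      _ < n := hn
      _ ≤ n ^ (A ^ 2 / B) := by
          refine Real.self_le_rpow_of_one_le (by linarith) ?_
          rw [one_le_div (by linarith)]
          nlinarith
  · rw [G.probNumVerticesGe_eq_zero q (not_le.mp hcn)]
    exact mul_pos (Real.rpow_pos_of_pos hn0 _) hqpos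

end MultiHypergraph

theorem mainTheorem5 :
    (∀ A : ℝ, 1 < A → ∃ n₀ : ℕ, ∀ B : ℝ, 1 < B → B < A →
      ∀ (V : Type*) (E : Type*) [Finite V] [Fintype E] (G : MultiHypergraph V E),
        n₀ ≤ G.numVertices →
        (∀ e : E, (G.rank e : ℝ) ≤ (G.numVertices : ℝ) / A) →
        ∀ q : ℝ, 0 < q → q < 1 →
          G.probNumVerticesGe q ((⌈B * ((G.numVertices : ℝ) / A)⌉ : ℝ) + 1) <
            (G.numVertices : ℝ) ^ (A ^ 2 / B) * q ^ (B * (G.minCut : ℝ))) ∧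
    (∃ n₀ : ℕ,
      ∀ (V : Type*) (E : Type*) [Finite V] [Fintype E] (G : MultiHypergraph V E),
        n₀ ≤ G.numVertices →
        (∀ e : E, (G.rank e : ℝ) ≤ (G.numVertices : ℝ) / 2) →
        ∀ q : ℝ, 0 < q → q < 1 →
          G.probNumVerticesGe q (0.8 * (G.numVertices : ℝ)) ≤
            (G.numVertices : ℝ) ^ (2.7 : ℝ) * q ^ (1.5 * (G.minCut : ℝ))) := by
  refine ⟨fun A hA => ?_, ?_⟩
  · obtain ⟨n₀, hn₀⟩ := exists_nat_gt (A ^ (2 * A * (A + 1)))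
    refine ⟨n₀, fun B hB hBA V E _ _ G hn hrank q hq hq1 => ?_⟩
    exact G.probNumVerticesGe_ceil_lt hB hBA (hn₀.trans_le (Nat.cast_le.mpr hn)) hrank hq hq1
  · obtain ⟨n₀, hn₀⟩ := exists_nat_gt ((2 : ℝ) ^ (2 * (2 : ℝ) * (2 + 1)))
    -- `40` ensures `0.75 n + 2 ≤ 0.8 n`, absorbing the ceiling and the `+ 1`; with `A = 2`, `B =
    -- 1.5` the exponent is `8/3 < 2.7`.
    refine ⟨max n₀ 40, fun V E _ _ G hn hrank q hq hq1 => ?_⟩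
    have hn' : (40 : ℝ) ≤ G.numVertices := by exact_mod_cast (le_max_right _ _).trans hn
    have h := G.probNumVerticesGe_ceil_lt (A := 2) (B := 1.5) (by norm_num) (by norm_num)
      (hn₀.trans_le (Nat.cast_le.mpr ((le_max_left _ _).trans hn))) hrank hq hq1
    have hle : (⌈1.5 * ((G.numVertices : ℝ) / 2)⌉ : ℝ) + 1 ≤ 0.8 * G.numVertices := by
      have := Int.ceil_lt_add_one (1.5 * ((G.numVertices : ℝ) / 2))
      linarith
    refine (G.probNumVerticesGe_antitone hq hq1 hle).trans (h.le.trans ?_)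
    refine mul_le_mul_of_nonneg_right ?_ (Real.rpow_nonneg hq.le _)
    exact Real.rpow_le_rpow_of_exponent_le (by linarith) (by norm_num)
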